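/- **Conventions.** An *uncertainty space* $(X,\Sigma)$ is a set $X$ with an algebra $\Sigma$ of subsets of $X$ (its measurable sets). *Upper probability polynomial functors* are built from the identity $Id$ and the constants $M$ ($M=(M,\Sigma_M)$ an uncertainty space) by binary products, binary coproducts and $\Delta^*$; they are treated as formal expressions. The set $\mathsf{Ing}\,T$ of ingredients of $T$ is $\{T,Id\}$ if $T$ is $Id$ or a constant, $\{T\}\cup\mathsf{Ing}\,T_1\cup\mathsf{Ing}\,T_2$ if $T=T_1\times T_2$ or $T=T_1+T_2$, and $\{T\}\cup\mathsf{Ing}\,S$ if $T=\Delta^*S$. Its labelled edges are $S_1\times S_2\overset{\mathsf{pr}_j}{\rightsquigarrow}S_j$, $S_1+S_2\overset{\mathsf{in}_j}{\rightsquigarrow}S_j$, $Id\overset{\mathsf{next}}{\rightsquigarrow}T$ and $\Delta^*S\overset{(p,q)}{\rightsquigarrow}S$ for $p,q\in[0,1]$. *Formulas* $\varphi:S$ of sort $S\in\mathsf{Ing}\,T$ are: $\bot_S$; $\varphi\to\psi$ for $\varphi,\psi:S$; for $S=M$ constant, every $A\in\Sigma_M$ and every singleton $A=\{c\}$, $c\in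 M$; $[\kappa]\varphi$ for an edge $S\overset{\kappa}{\rightsquigarrow}S'$ with $\kappa\neq(p,q)$ and $\varphi:S'$; and $[(p,q)]\varphi:\Delta^*S$ for $\varphi::S$. Here $\varphi::S$ ("measurable") means that every set occurring in $\varphi$ is measurable. $\neg,\vee,\wedge,\leftrightarrow,\top$ are the usual abbreviations; an empty conjunction is $\top$, an empty disjunction is $\bot$. For $\varphi::S$ put $U^{\ge p}\varphi=[(p,0)]\varphi$, $L^{\ge p}\varphi=[(0,p)]\varphi$, $U^{\le p}\varphi=[(0,1-p)]\neg\varphi$, $U^{<p}\varphi=\neg U^{\ge p}\varphi$. *Axioms.* (1) All Boolean tautologies. (2) For $S=M$, $c\in M$ and a formula $A:M$ given by a set: $\{c\}\to A$ if $c\in A$, and $\{c\}\to\neg A$ if $c\notin A$. (3) $\neg[\kappa]\varphi\to[\kappa]\neg\varphi$ for $\kappa\in\{\mathsf{pr}_j,\mathsf{in}_j,\mathsf{next}\}$; $\neg[\mathsf{pr}_j]\bot$; $\neg[\mathsf{next}]\bot$; $\neg[\mathsf{in}_1]\bot\leftrightarrow[\mathsf{in}_2]\bot$. (4) For $\varphi,\psi::S$,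 of sort $\Delta^*S$: $U^{\le p}\varphi\to U^{<q}\varphi$ for $p<q$; $U^{<p}\varphi\to U^{\le p}\varphi$; $L^{\ge1}(\varphi\to\psi)\to(U^{\ge p}\varphi\to U^{\ge p}\psi)$; $[(p,q)]\varphi\leftrightarrow(U^{\ge p}\varphi\wedge L^{\ge q}\varphi)$. A *$T$-deduction system* $D$ is a family of relations $\Gamma\vdash_S\varphi$ ($S\in\mathsf{Ing}\,T$, $\Gamma$ a set of formulas of sort $S$, $\varphi:S$) such that: - $\Gamma\vdash_S\varphi$ if $\varphi\in\Gamma$ or $\varphi$ is an axiom of sort $S$; $\{\varphi,\varphi\to\psi\}\vdash_S\psi$; - (cut) $\Gamma\vdash_S\lambda$ for all $\lambda\in\Lambda$ and $\Lambda\vdash_S\varphi$ imply $\Gamma\vdash_S\varphi$; (deduction) $\Gamma\cup\{\varphi\}\vdash_S\psi$ implies $\Gamma\vdash_S\varphi\to\psi$; - (necessitation) if $\Delta^*S\in\mathsf{Ing}\,T$, $\varphi::S$ and $\vdash_S\varphi$, then $\vdash_{\Delta^*S}L^{\ge1}\varphi$; - (constant) $\{\neg\{c\}: c\in M\}\vdash_M\bot$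 for every constant $M\in\mathsf{Ing}\,T$; - (definite box) for an edge $S\overset{\kappa}{\rightsquigarrow}S'$, $\kappa\ne(p,q)$: $\Gamma\vdash_{S'}\psi$ implies $\{[\kappa]\gamma:\gamma\in\Gamma\}\vdash_S[\kappa]\psi$; - (Archimedean) $\{U^{\ge q}\psi: q\in[0,1],\,q<p\}\vdash_{\Delta^*S}U^{\ge p}\psi$ for $\psi::S$ and $p\in[0,1]$, and the same with $L$ in place of $U$; - (cover rules) for $m,k\ge0$, $\varphi,\varphi_1,\dots,\varphi_m::S$ and $p_1,\dots,p_m\in[0,1]$, write $\chi_r=\bigvee_{I\subseteq\{1,\dots,m\},|I|=r}\bigwedge_{i\in I}\varphi_i$. If $n\ge1$, $\vdash_S\varphi\to\chi_{n+k}$, $\vdash_S\chi_k$ and $p=\max\bigl(0,\min(1,\tfrac{\sum_i p_i-k}{n})\bigr)$, then $\vdash_{\Delta^*S}\bigwedge_iU^{\le p_i}\varphi_i\to U^{\le p}\varphi$. If $\vdash_S\chi_k$ and $\sum_ip_i<k$, then $\vdash_{\Delta^*S}\neg\bigwedge_iU^{\le p_i}\varphi_i$. A set $x$ of formulas of sort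 $S$ is *maximal* if $x\not\vdash_S\bot_S$ and, for every $\varphi:S$, $\varphi\in x$ iff $\neg\varphi\notin x$. $D$ is *Lindenbaum* if for every $S\in\mathsf{Ing}\,T$ every $\Gamma$ with $\Gamma\not\vdash_S\bot_S$ is included in a maximal set. Let $X_S^D$ be the set of maximal sets of sort $S$, $|\varphi|_S=\{x\in X_S^D:\varphi\in x\}$, and $\Sigma_S^D=\{|\varphi|_S:\varphi::S\}$, which is an algebra of subsets of $X_S^D$. A function $g:\Sigma\to[0,1]$ on an algebra $\Sigma$ of subsets of $X$ is an *upper probability measure* if there is a nonempty set $\mathcal P$ of finitely additive probability measures on $\Sigma$ with $g(U)=\sup_{\mu\in\mathcal P}\mu(U)$ for all $U\in\Sigma$. Sets $U_1,\dots,U_m\in\Sigma$ form an *$(n,k)$-cover* of $(U,X)$ if every point of $X$ lies in at least $k$, and every point of $U$ in at least $n+k$, of the $U_i$ (counted by index). **Theorem.** Let $T$ be an upper probability polynomial functor, $D$ a Lindenbaum $T$-deduction system, $\Delta^*S\in\mathsf{Ing}\,T$, and $x\in X^D_{\Delta^*S}$. Then $$g_x(|\varphi|_S)=\sup\{q\in[0,1]: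 U^{\ge q}\varphi\in x\}\qquad(\varphi::S)$$ is a well defined function $g_x:\Sigma_S^D\to[0,1]$: the supremum is over a nonempty set and depends only on the set $|\varphi|_S$. Moreover $g_x$ is an upper probability measure on $\Sigma_S^D$. In particular it satisfies - (UP1) $g_x(\emptyset)=0$; - (UP2) $g_x(X_S^D)=1$; - (UP3) $k+n\,g_x(U)\le\sum_{i=1}^m g_x(U_i)$ for all non-negative integers $m,n,k$, all $U\in\Sigma_S^D$ and all $(n,k)$-covers $U_1,\dots,U_m$ of $(U,X_S^D)$ by members of $\Sigma_S^D$. -/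

import Mathlib

universe u

namespace UpperProbLogic

/-! ### Uncertainty spaces and upper probability measures -/

/-- An uncertainty space: a set with an algebra of subsets, its measurable sets. -/
structure UncSpace : Type (u + 1) where
  carrier : Type u
  algebra : Set (Set carrier)
  isAlgebra : MeasureTheory.IsSetAlgebra algebra

namespace UncSpace

/-- The measurable sets of an uncertainty space. -/
abbrev Meas (X : UncSpace.{u}) : Type u := {U : Set X.carrier // U ∈ X.algebra}

def empty (X : UncSpace.{u}) : X.Meas := ⟨∅, X.isAlgebra.empty_mem⟩

def whole (X : UncSpace.{u}) : X.Meas := ⟨Set.univ, X.isAlgebra.univ_mem⟩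

def union {X : UncSpace.{u}} (U V : X.Meas) : X.Meas :=
  ⟨U.1 ∪ V.1, X.isAlgebra.union_mem U.2 V.2⟩

end UncSpace

/-- A finitely additive probability measure with values in `[0,1]`. -/
structure FinAddProb (X : UncSpace.{u}) : Type u where
  toFun : X.Meas → unitInterval
  map_empty : toFun X.empty = 0
  map_whole : toFun X.whole = 1
  map_union : ∀ U V : X.Meas, Disjoint U.1 V.1 →
    (toFun (UncSpace.union U V) : ℝ) = (toFun U : ℝ) + (toFun V : ℝ)

/-- The upper probability of a measurable set with respect to a family of probability measures. -/
noncomputable def upperEnvelope {X : UncSpace.{u}} (P : Set (FinAddProb X)) (U : X.Meas) : ℝ :=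
  sSup ((fun μ : FinAddProb X => (μ.toFun U : ℝ)) '' P)

/-- `g` is an upper probability measure: the pointwise supremum of a nonempty family of finitely
additive probability measures. -/
def IsUpperProbability (X : UncSpace.{u}) (g : X.Meas → unitInterval) : Prop :=
  ∃ P : Set (FinAddProb X), P.Nonempty ∧ ∀ U : X.Meas, (g U : ℝ) = upperEnvelope P U

/-- Every point of `U` lies in `V i` for at least `n` different indices `i`. -/
def Covers {α : Type u} {m : ℕ} (V : Fin m → Set α) (n : ℕ) (U : Set α) : Prop :=
  ∀ x ∈ U, ∃ J : Finset (Fin m), J.card = n ∧ ∀ i ∈ J, x ∈ V i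

/-- The sequence `V` is an `(n,k)`-cover of `(U,X)`: it covers the whole space `X` `k` times and
`U` `n + k` times. -/
def IsNKCover {X : UncSpace.{u}} {m : ℕ} (n k : ℕ) (V : Fin m → X.Meas) (U : X.Meas) : Prop :=
  Covers (fun i => (V i).1) k Set.univ ∧ Covers (fun i => (V i).1) (n + k) U.1

/-! ### Upper probability polynomial functors and their ingredients -/

/-- The expressions for upper probability polynomial functors: identity, constants, binary
products and coproducts, and application of `Δ*`. -/
inductive PolyFunctor : Type (u + 1) where
  | ident : PolyFunctor
  | const (M : UncSpace.{u}) : PolyFunctor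
  | prod (S₁ S₂ : PolyFunctor) : PolyFunctor
  | coprod (S₁ S₂ : PolyFunctor) : PolyFunctor
  | upper (S : PolyFunctor) : PolyFunctor

/-- The set of ingredients of a functor. -/
def PolyFunctor.Ing : PolyFunctor.{u} → Set PolyFunctor.{u}
  | .ident => {.ident}
  | .const M => {.const M, .ident}
  | .prod S₁ S₂ => {.prod S₁ S₂} ∪ (S₁.Ing ∪ S₂.Ing)
  | .coprod S₁ S₂ => {.coprod S₁ S₂} ∪ (S₁.Ing ∪ S₂.Ing)
  | .upper S => {.upper S} ∪ S.Ing

/-- The edges of the labelled multigraph of ingredients of `T`, except for those labelled `(p,q)`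
that lead from `Δ*S` to `S`. -/
inductive Edge (T : PolyFunctor.{u}) : PolyFunctor.{u} → PolyFunctor.{u} → Type (u + 1) where
  | pr₁ (S₁ S₂ : PolyFunctor.{u}) : Edge T (.prod S₁ S₂) S₁
  | pr₂ (S₁ S₂ : PolyFunctor.{u}) : Edge T (.prod S₁ S₂) S₂
  | in₁ (S₁ S₂ : PolyFunctor.{u}) : Edge T (.coprod S₁ S₂) S₁
  | in₂ (S₁ S₂ : PolyFunctor.{u}) : Edge T (.coprod S₁ S₂) S₂
  | next : Edge T .ident T

theorem PolyFunctor.self_mem_Ing (T : PolyFunctor.{u}) : T ∈ T.Ing := by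
  cases T <;> simp [PolyFunctor.Ing]

theorem PolyFunctor.Ing_trans {T S R : PolyFunctor.{u}} (hS : S ∈ T.Ing) (hR : R ∈ S.Ing) :
    R ∈ T.Ing := by
  induction T with
  | ident =>
    simp only [PolyFunctor.Ing, Set.mem_singleton_iff] at hS
    subst hS
    exact hR
  | const M =>
    simp only [PolyFunctor.Ing, Set.mem_insert_iff, Set.mem_singleton_iff] at hS
    rcases hS with rfl | rfl
    · exact hR
    · simp only [PolyFunctor.Ing, Set.mem_singleton_iff] at hR
      subst hR
      simp [PolyFunctor.Ing]
  | prod S₁ S₂ ih₁ ih₂ =>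
    rcases hS with rfl | hS | hS
    · exact hR
    · exact Or.inr (Or.inl (ih₁ hS))
    · exact Or.inr (Or.inr (ih₂ hS))
  | coprod S₁ S₂ ih₁ ih₂ =>
    rcases hS with rfl | hS | hS
    · exact hR
    · exact Or.inr (Or.inl (ih₁ hS))
    · exact Or.inr (Or.inr (ih₂ hS))
  | upper S' ih =>
    rcases hS with rfl | hS
    · exact hR
    · exact Or.inr (ih hS)

theorem PolyFunctor.of_upper_mem_Ing {T S : PolyFunctor.{u}}
    (h : PolyFunctor.upper S ∈ T.Ing) : S ∈ T.Ing :=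
  PolyFunctor.Ing_trans h (Or.inr S.self_mem_Ing)

theorem Edge.target_mem_Ing {T S S' : PolyFunctor.{u}} (κ : Edge T S S') (h : S ∈ T.Ing) :
    S' ∈ T.Ing := by
  cases κ with
  | pr₁ _ S₂ => exact PolyFunctor.Ing_trans h (Or.inr (Or.inl (PolyFunctor.self_mem_Ing _)))
  | pr₂ S₁ _ => exact PolyFunctor.Ing_trans h (Or.inr (Or.inr (PolyFunctor.self_mem_Ing _)))
  | in₁ _ S₂ => exact PolyFunctor.Ing_trans h (Or.inr (Or.inl (PolyFunctor.self_mem_Ing _)))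
  | in₂ S₁ _ => exact PolyFunctor.Ing_trans h (Or.inr (Or.inr (PolyFunctor.self_mem_Ing _)))
  | next => exact T.self_mem_Ing

/-! ### Formulas -/

/-- Raw formulas of the language of `T`, by sort, without the restrictions on the sets that occur
in them. -/
inductive PreForm (T : PolyFunctor.{u}) : PolyFunctor.{u} → Type (u + 1) where
  | bot (S : PolyFunctor.{u}) : PreForm T S
  | imp {S : PolyFunctor.{u}} (φ ψ : PreForm T S) : PreForm T S
  | atom (M : UncSpace.{u}) (A : Set M.carrier) : PreForm T (.const M)
  | modal {S S' : PolyFunctor.{u}} (κ : Edge T S S') (φ : PreForm T S') : PreForm T S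
  | box {S : PolyFunctor.{u}} (p q : unitInterval) (φ : PreForm T S) : PreForm T (.upper S)

/-- Every set that occurs in the formula is measurable. -/
def PreForm.IsMeasurable {T : PolyFunctor.{u}} :
    {S : PolyFunctor.{u}} → PreForm T S → Prop
  | _, .bot _ => True
  | _, .imp φ ψ => φ.IsMeasurable ∧ ψ.IsMeasurable
  | _, .atom M A => A ∈ M.algebra
  | _, .modal _ φ => φ.IsMeasurable
  | _, .box _ _ φ => φ.IsMeasurable

/-- The formation rules: a set that occurs in a formula is measurable or a singleton, and the
operators `[(p,q)]` are applied only to measurable formulas. -/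
def PreForm.WellFormed {T : PolyFunctor.{u}} :
    {S : PolyFunctor.{u}} → PreForm T S → Prop
  | _, .bot _ => True
  | _, .imp φ ψ => φ.WellFormed ∧ ψ.WellFormed
  | _, .atom M A => A ∈ M.algebra ∨ ∃ c : M.carrier, A = {c}
  | _, .modal _ φ => φ.WellFormed
  | _, .box _ _ φ => φ.IsMeasurable

/-- The formulas of sort `S`. -/
def Form (T S : PolyFunctor.{u}) : Type (u + 1) := {φ : PreForm T S // φ.WellFormed}

/-- The measurable formulas of sort `S`, written `φ :: S`. -/
def MForm (T S : PolyFunctor.{u}) : Type (u + 1) := {φ : Form T S // φ.1.IsMeasurable}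

namespace Form

variable {T S S' S₁ S₂ : PolyFunctor.{u}}

def bot : Form T S := ⟨.bot S, trivial⟩

def imp (φ ψ : Form T S) : Form T S := ⟨.imp φ.1 ψ.1, φ.2, ψ.2⟩

def neg (φ : Form T S) : Form T S := imp φ bot

def or (φ ψ : Form T S) : Form T S := imp (neg φ) ψ

def and (φ ψ : Form T S) : Form T S := neg (or (neg φ) (neg ψ))

def iff (φ ψ : Form T S) : Form T S := and (imp φ ψ) (imp ψ φ)

def top : Form T S := neg bot

/-- Finite conjunctions and disjunctions; the empty ones are `⊤` and `⊥`. -/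
def bigAnd : List (Form T S) → Form T S := List.foldr and top

def bigOr : List (Form T S) → Form T S := List.foldr or bot

/-- The disjunction, over all `r`-element subsets `I` of the index set, of the conjunctions of the
formulas with index in `I`. -/
def atLeast {m : ℕ} (r : ℕ) (φ : Fin m → Form T S) : Form T S :=
  bigOr ((List.sublistsLen r (List.finRange m)).map fun J => bigAnd (J.map φ))

def atom {M : UncSpace.{u}} (A : Set M.carrier)
    (hA : A ∈ M.algebra ∨ ∃ c : M.carrier, A = {c}) : Form T (.const M) := ⟨.atom M A, hA⟩

def single {M : UncSpace.{u}} (c : M.carrier) : Form T (.const M) :=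
  atom {c} (Or.inr ⟨c, rfl⟩)

/-- `[κ]φ` for a label `κ` that is not of the form `(p,q)`. -/
def modal (κ : Edge T S S') (φ : Form T S') : Form T S := ⟨.modal κ φ.1, φ.2⟩

/-- `φ` is a Boolean tautology: every assignment of truth values to the formulas of its sort that
respects `⊥` and `→` makes it true. -/
def IsTautology (φ : Form T S) : Prop :=
  ∀ v : Form T S → Prop, ¬ v bot → (∀ ψ χ : Form T S, v (imp ψ χ) ↔ (v ψ → v χ)) → v φ

end Form

namespace MForm

variable {T S : PolyFunctor.{u}}

def bot : MForm T S := ⟨Form.bot, trivial⟩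

def imp (φ ψ : MForm T S) : MForm T S := ⟨Form.imp φ.1 ψ.1, φ.2, ψ.2⟩

def neg (φ : MForm T S) : MForm T S := imp φ bot

/-- `[(p,q)]φ`. -/
def box (p q : unitInterval) (φ : MForm T S) : Form T (.upper S) := ⟨.box p q φ.1.1, φ.2⟩

/-- The upper probability of `φ` is at least `p`. -/
def upperGE (p : unitInterval) (φ : MForm T S) : Form T (.upper S) := box p 0 φ

/-- The lower probability of `φ` is at least `p`. -/
def lowerGE (p : unitInterval) (φ : MForm T S) : Form T (.upper S) := box 0 p φ

/-- The upper probability of `φ` is at most `p`. -/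
def upperLE (p : unitInterval) (φ : MForm T S) : Form T (.upper S) :=
  box 0 (unitInterval.symm p) (neg φ)

/-- The upper probability of `φ` is less than `p`. -/
def upperLT (p : unitInterval) (φ : MForm T S) : Form T (.upper S) := Form.neg (upperGE p φ)

end MForm

/-! ### Axioms and deduction systems -/

/-- The axioms of the language of `T`, by sort. -/
inductive IsAxiom (T : PolyFunctor.{u}) : (S : PolyFunctor.{u}) → Form T S → Prop where
  | taut {S : PolyFunctor.{u}} (φ : Form T S) (h : φ.IsTautology) : IsAxiom T S φ
  | const_mem {M : UncSpace.{u}} (A : Set M.carrier)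
      (hA : A ∈ M.algebra ∨ ∃ m : M.carrier, A = {m}) (c : M.carrier) (hc : c ∈ A) :
      IsAxiom T (.const M) (Form.imp (Form.single c) (Form.atom A hA))
  | const_not_mem {M : UncSpace.{u}} (A : Set M.carrier)
      (hA : A ∈ M.algebra ∨ ∃ m : M.carrier, A = {m}) (c : M.carrier) (hc : c ∉ A) :
      IsAxiom T (.const M) (Form.imp (Form.single c) (Form.neg (Form.atom A hA)))
  | functional {S S' : PolyFunctor.{u}} (κ : Edge T S S') (φ : Form T S') :
      IsAxiom T S (Form.imp (Form.neg (Form.modal κ φ)) (Form.modal κ (Form.neg φ)))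
  | pr₁_total (S₁ S₂ : PolyFunctor.{u}) :
      IsAxiom T (.prod S₁ S₂) (Form.neg (Form.modal (.pr₁ S₁ S₂) Form.bot))
  | pr₂_total (S₁ S₂ : PolyFunctor.{u}) :
      IsAxiom T (.prod S₁ S₂) (Form.neg (Form.modal (.pr₂ S₁ S₂) Form.bot))
  | in_total (S₁ S₂ : PolyFunctor.{u}) :
      IsAxiom T (.coprod S₁ S₂) (Form.iff (Form.neg (Form.modal (.in₁ S₁ S₂) Form.bot))
        (Form.modal (.in₂ S₁ S₂) Form.bot))
  | next_total : IsAxiom T .ident (Form.neg (Form.modal .next Form.bot))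
  | upper_le_lt {S : PolyFunctor.{u}} (p q : unitInterval) (hpq : p < q) (φ : MForm T S) :
      IsAxiom T (.upper S) (Form.imp (φ.upperLE p) (φ.upperLT q))
  | upper_lt_le {S : PolyFunctor.{u}} (p : unitInterval) (φ : MForm T S) :
      IsAxiom T (.upper S) (Form.imp (φ.upperLT p) (φ.upperLE p))
  | upper_mono {S : PolyFunctor.{u}} (p : unitInterval) (φ ψ : MForm T S) :
      IsAxiom T (.upper S) (Form.imp ((MForm.imp φ ψ).lowerGE 1)
        (Form.imp (φ.upperGE p) (ψ.upperGE p)))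
  | upper_box {S : PolyFunctor.{u}} (p q : unitInterval) (φ : MForm T S) :
      IsAxiom T (.upper S) (Form.iff (φ.box p q) (Form.and (φ.upperGE p) (φ.lowerGE q)))

/-- A `T`-deduction system: relations `Γ ⊢_S φ`, one for each ingredient `S` of `T`, that satisfy
the rules below. `Entails h Γ φ`, with `h : S ∈ Ing T`, stands for `Γ ⊢_S φ`. -/
structure DeductionSystem (T : PolyFunctor.{u}) where
  Entails : {S : PolyFunctor.{u}} → S ∈ T.Ing → Set (Form T S) → Form T S → Prop
  assumption {S : PolyFunctor.{u}} (h : S ∈ T.Ing) (Γ : Set (Form T S)) (φ : Form T S) :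
    φ ∈ Γ ∨ IsAxiom T S φ → Entails h Γ φ
  modusPonens {S : PolyFunctor.{u}} (h : S ∈ T.Ing) (φ ψ : Form T S) :
    Entails h {φ, Form.imp φ ψ} ψ
  cut {S : PolyFunctor.{u}} (h : S ∈ T.Ing) (Γ Λ : Set (Form T S)) (φ : Form T S) :
    (∀ ψ ∈ Λ, Entails h Γ ψ) → Entails h Λ φ → Entails h Γ φ
  deduction {S : PolyFunctor.{u}} (h : S ∈ T.Ing) (Γ : Set (Form T S)) (φ ψ : Form T S) :
    Entails h (Γ ∪ {φ}) ψ → Entails h Γ (Form.imp φ ψ)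
  necessitation {S : PolyFunctor.{u}} (h : PolyFunctor.upper S ∈ T.Ing) (φ : MForm T S) :
    Entails (PolyFunctor.of_upper_mem_Ing h) ∅ φ.1 → Entails h ∅ (φ.lowerGE 1)
  constant {M : UncSpace.{u}} (h : PolyFunctor.const M ∈ T.Ing) :
    Entails h (Set.range fun c : M.carrier => Form.neg (Form.single c)) Form.bot
  definiteBox {S S' : PolyFunctor.{u}} (h : S ∈ T.Ing) (κ : Edge T S S')
    (Γ : Set (Form T S')) (ψ : Form T S') :
    Entails (κ.target_mem_Ing h) Γ ψ → Entails h (Form.modal κ '' Γ) (Form.modal κ ψ)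
  archimedeanUpper {S : PolyFunctor.{u}} (h : PolyFunctor.upper S ∈ T.Ing) (p : unitInterval)
    (ψ : MForm T S) : Entails h ((fun q => ψ.upperGE q) '' {q | q < p}) (ψ.upperGE p)
  archimedeanLower {S : PolyFunctor.{u}} (h : PolyFunctor.upper S ∈ T.Ing) (p : unitInterval)
    (ψ : MForm T S) : Entails h ((fun q => ψ.lowerGE q) '' {q | q < p}) (ψ.lowerGE p)
  /-- Here `Set.projIcc 0 1 _ r` is `max 0 (min 1 r)`. -/
  cover₁ {S : PolyFunctor.{u}} (h : PolyFunctor.upper S ∈ T.Ing) (m n k : ℕ) (hn : 1 ≤ n)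
    (φ : MForm T S) (ψ : Fin m → MForm T S) (p : Fin m → unitInterval) :
    Entails (PolyFunctor.of_upper_mem_Ing h) ∅
      (Form.imp φ.1 (Form.atLeast (n + k) fun i => (ψ i).1)) →
    Entails (PolyFunctor.of_upper_mem_Ing h) ∅ (Form.atLeast k fun i => (ψ i).1) →
    Entails h ∅ (Form.imp (Form.bigAnd (List.ofFn fun i => (ψ i).upperLE (p i)))
      (φ.upperLE (Set.projIcc 0 1 zero_le_one (((∑ i, (p i : ℝ)) - k) / n))))
  cover₂ {S : PolyFunctor.{u}} (h : PolyFunctor.upper S ∈ T.Ing) (m k : ℕ)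
    (ψ : Fin m → MForm T S) (p : Fin m → unitInterval) :
    Entails (PolyFunctor.of_upper_mem_Ing h) ∅ (Form.atLeast k fun i => (ψ i).1) →
    (∑ i, (p i : ℝ)) < k →
    Entails h ∅ (Form.neg (Form.bigAnd (List.ofFn fun i => (ψ i).upperLE (p i))))

namespace DeductionSystem

variable {T S : PolyFunctor.{u}} (D : DeductionSystem T)

def IsConsistent (h : S ∈ T.Ing) (Γ : Set (Form T S)) : Prop := ¬ D.Entails h Γ Form.bot

/-- Negation complete and consistent. -/
def IsMaximal (h : S ∈ T.Ing) (Γ : Set (Form T S)) : Prop :=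
  (∀ φ : Form T S, φ ∈ Γ ↔ Form.neg φ ∉ Γ) ∧ D.IsConsistent h Γ

/-- Every consistent set of formulas of a sort is included in a maximal one. -/
def IsLindenbaum : Prop :=
  ∀ (S : PolyFunctor.{u}) (h : S ∈ T.Ing) (Γ : Set (Form T S)), D.IsConsistent h Γ →
    ∃ Δ : Set (Form T S), Γ ⊆ Δ ∧ D.IsMaximal h Δ

/-! ### Canonical spaces and canonical measures -/

/-- The points of the canonical space of sort `S`: the maximal sets of formulas. -/
def CanonicalPoint (h : S ∈ T.Ing) : Type (u + 1) := {x : Set (Form T S) // D.IsMaximal h x}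

/-- The set `|φ|_S` of the maximal sets that contain `φ`. -/
def truthSet (h : S ∈ T.Ing) (φ : Form T S) : Set (D.CanonicalPoint h) := {x | φ ∈ x.1}

/-- The family of all sets `|φ|_S` with `φ :: S`. -/
def canonicalAlgebra (h : S ∈ T.Ing) : Set (Set (D.CanonicalPoint h)) :=
  Set.range fun φ : MForm T S => D.truthSet h φ.1

theorem bot_not_mem {D : DeductionSystem T} {h : S ∈ T.Ing} (x : D.CanonicalPoint h) :
    Form.bot ∉ x.1 := fun hb => x.2.2 (D.assumption h _ _ (Or.inl hb))

theorem neg_mem_iff {D : DeductionSystem T} {h : S ∈ T.Ing} (x : D.CanonicalPoint h)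
    (φ : Form T S) : Form.neg φ ∈ x.1 ↔ φ ∉ x.1 := by
  have := x.2.1 φ
  tauto

theorem entails_mp {D : DeductionSystem T} {h : S ∈ T.Ing} {Γ : Set (Form T S)}
    {φ ψ : Form T S} (h₁ : D.Entails h Γ φ) (h₂ : D.Entails h Γ (Form.imp φ ψ)) :
    D.Entails h Γ ψ := by
  refine D.cut h Γ {φ, Form.imp φ ψ} ψ ?_ (D.modusPonens h φ ψ)
  rintro χ (rfl | rfl)
  · exact h₁
  · exact h₂

theorem mem_of_entails {D : DeductionSystem T} {h : S ∈ T.Ing} (x : D.CanonicalPoint h)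
    {φ : Form T S} (hφ : D.Entails h x.1 φ) : φ ∈ x.1 := by
  by_contra hn
  exact x.2.2 (entails_mp hφ (D.assumption h _ _ (Or.inl ((neg_mem_iff x φ).2 hn))))

theorem imp_mem_iff {D : DeductionSystem T} {h : S ∈ T.Ing} (x : D.CanonicalPoint h)
    (φ ψ : Form T S) : Form.imp φ ψ ∈ x.1 ↔ (φ ∈ x.1 → ψ ∈ x.1) := by
  constructor
  · intro hi hφ
    exact mem_of_entails x (entails_mp (D.assumption h _ _ (Or.inl hφ))
      (D.assumption h _ _ (Or.inl hi)))
  · intro hi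
    by_cases hφ : φ ∈ x.1
    · refine mem_of_entails x (D.deduction h _ _ _ (D.assumption h _ _ (Or.inl ?_)))
      exact Or.inl (hi hφ)
    · refine mem_of_entails x (D.deduction h _ _ _ ?_)
      have hb : D.Entails h (x.1 ∪ {φ}) Form.bot :=
        entails_mp (D.assumption h _ φ (Or.inl (Or.inr rfl)))
          (D.assumption h _ _ (Or.inl (Or.inl ((neg_mem_iff x φ).2 hφ))))
      refine entails_mp hb (D.assumption h _ _ (Or.inr (IsAxiom.taut _ ?_)))
      intro v hv hi'
      exact (hi' _ _).2 fun hvb => absurd hvb hv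

theorem canonicalAlgebra_isSetAlgebra (h : S ∈ T.Ing) :
    MeasureTheory.IsSetAlgebra (D.canonicalAlgebra h) where
  empty_mem := by
    refine ⟨MForm.bot, Set.eq_empty_iff_forall_notMem.2 fun x hx => bot_not_mem x hx⟩
  compl_mem := by
    rintro _ ⟨φ, rfl⟩
    exact ⟨φ.neg, Set.ext fun x => neg_mem_iff x φ.1⟩
  union_mem := by
    rintro _ _ ⟨φ, rfl⟩ ⟨ψ, rfl⟩
    refine ⟨MForm.imp φ.neg ψ, Set.ext fun x => ?_⟩
    have h₁ := imp_mem_iff x (Form.neg φ.1) ψ.1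
    have h₂ := neg_mem_iff x φ.1
    change Form.imp (Form.neg φ.1) ψ.1 ∈ x.1 ↔ (φ.1 ∈ x.1 ∨ ψ.1 ∈ x.1)
    tauto

/-- The canonical uncertainty space of sort `S`. -/
def canonicalSpace (h : S ∈ T.Ing) : UncSpace.{u + 1} :=
  ⟨D.CanonicalPoint h, D.canonicalAlgebra h, D.canonicalAlgebra_isSetAlgebra h⟩

/-- The set `|φ|_S`, for `φ :: S`, as a measurable set of the canonical space. -/
def measTruthSet (h : S ∈ T.Ing) (φ : MForm T S) : (D.canonicalSpace h).Meas :=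
  ⟨D.truthSet h φ.1, φ, rfl⟩

/-- `g` satisfies the defining equation of `g_x`: for every `φ :: S`, the value `g |φ|_S` is the
supremum of the numbers `q ∈ [0,1]` for which `x` contains the formula saying that the upper
probability of `φ` is at least `q`. The supremum is taken in `ℝ`. -/
def IsCanonicalMeasure (h : PolyFunctor.upper S ∈ T.Ing) (x : D.CanonicalPoint h)
    (g : (D.canonicalSpace (PolyFunctor.of_upper_mem_Ing h)).Meas → unitInterval) : Prop :=
  ∀ φ : MForm T S,
    IsLUB ((fun q : unitInterval => (q : ℝ)) '' {q | φ.upperGE q ∈ x.1})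
      (g (D.measTruthSet (PolyFunctor.of_upper_mem_Ing h) φ) : ℝ)

end DeductionSystem

end UpperProbLogic

open UpperProbLogic

namespace UpperProbLogic

/-! ### Covers and upper probability measures -/

/-! The proof has a logical and an analytic half, joined by the cover inequality (UP3).

Logic: inside a maximal set `x` of sort `Δ*S`, the axioms and the Archimedean rules make `U^{≥p}φ ∈
x` equivalent to `p ≤ v` and `U^{≤p}φ ∈ x` equivalent to `v ≤ p`, for a single number `v`, the
canonical value of `φ` (`upperGE_mem_iff`, `upperLE_mem_iff`). By the Lindenbaum property, whatever
belongs to all maximal sets of sort `S` is provable (`provable_of_forall_mem`). Hence inclusions of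
truth sets become provable implications, which makes `v` depend on `|φ|` only, and covers become the
provable premises of the cover rules, which yield (UP3) when each `p_i` is the value of `φ_i`.

Analysis: the cover inequality and `g(X) = 1` give, for each `U`, a finitely additive probability `μ
≤ g` with `μ(U) = g(U)`, so `g` is the pointwise maximum of the probabilities below it. Rounding
extends the inequality to real weights; this is the positivity on the span of `X` and `U` that the
M. Riesz extension theorem needs. Formal combinations of sets replace step functions because `g` is
not additive, so its linear extension need not descend to functions. -/

theorem covers_of_le_card {α : Type u} {m : ℕ} {V : Fin m → Set α} {n : ℕ} {U : Set α}
    (h : ∀ x ∈ U, (n : ℝ) ≤ ∑ i, (V i).indicator (1 : α → ℝ) x) : Covers V n U := by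
  classical
  intro x hx
  have h₁ := h x hx
  simp only [Set.indicator_apply, Pi.one_apply, Finset.sum_boole, Nat.cast_le] at h₁
  obtain ⟨J, hJ, hc⟩ := Finset.exists_subset_card_eq h₁
  exact ⟨J, hc, fun i hi => (Finset.mem_filter.1 (hJ hi)).2⟩

/-- The inequality `k + n g(U) ≤ ∑ g(Vᵢ)` for all `(n,k)`-covers `V` of `U`. -/
def CoverInequality {X : UncSpace.{u}} (g : X.Meas → unitInterval) : Prop :=
  ∀ (m n k : ℕ) (V : Fin m → X.Meas) (U : X.Meas), IsNKCover n k V U →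
    (k : ℝ) + n * (g U : ℝ) ≤ ∑ i, (g (V i) : ℝ)

namespace UncSpace

variable {X : UncSpace.{u}}

/-- The characteristic function of a measurable set. -/
noncomputable def Meas.ind (U : X.Meas) : X.carrier → ℝ := Set.indicator U.1 1

theorem Meas.ind_nonneg (U : X.Meas) (x : X.carrier) : 0 ≤ U.ind x :=
  Set.indicator_nonneg (fun _ _ => zero_le_one) x

theorem Meas.ind_le_one (U : X.Meas) (x : X.carrier) : U.ind x ≤ 1 :=
  Set.indicator_apply_le' (fun _ => le_rfl) (fun _ => zero_le_one)

@[simp] theorem ind_whole (x : X.carrier) : X.whole.ind x = 1 := by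
  simp [Meas.ind, whole]

@[simp] theorem ind_empty (x : X.carrier) : X.empty.ind x = 0 := by
  simp [Meas.ind, empty]

theorem ind_union {U V : X.Meas} (h : Disjoint U.1 V.1) (x : X.carrier) :
    (union U V).ind x = U.ind x + V.ind x := by
  simp only [Meas.ind, union]
  rw [Set.indicator_union_of_disjoint h]

end UncSpace

open UncSpace

/-! ### Cover inequalities with weights -/

variable {X : UncSpace.{u}} {g : X.Meas → unitInterval}

theorem CoverInequality.of_fintype (hg : CoverInequality g) {ι : Type*} [Fintype ι]
    (V : ι → X.Meas) (U : X.Meas) (n k : ℕ)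
    (h : ∀ x, n * U.ind x + k ≤ ∑ i, (V i).ind x) :
    n * (g U : ℝ) + k ≤ ∑ i, (g (V i) : ℝ) := by
  let e := (Fintype.equivFin ι).symm
  have hsum : ∀ f : ι → ℝ, ∑ j, f (e j) = ∑ i, f i := fun f => e.sum_comp f
  rw [← hsum fun i => (g (V i) : ℝ), add_comm]
  refine hg _ n k (fun j => V (e j)) U ⟨covers_of_le_card fun x _ => ?_,
    covers_of_le_card fun x hx => ?_⟩
  · have h₁ := h x
    rw [← hsum fun i => (V i).ind x] at h₁
    have h₂ := mul_nonneg n.cast_nonneg (U.ind_nonneg x)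
    exact (le_add_of_nonneg_left h₂).trans h₁
  · have h₁ := h x
    rw [← hsum fun i => (V i).ind x] at h₁
    rw [show U.ind x = 1 by simp [Meas.ind, hx], mul_one] at h₁
    push_cast
    exact h₁

/-- The cover inequality with natural multiplicities. -/
theorem CoverInequality.of_nat (hg : CoverInequality g) (s : Finset X.Meas) (c : X.Meas → ℕ)
    (U : X.Meas) (n k : ℕ) (h : ∀ x, n * U.ind x + k ≤ ∑ V ∈ s, c V * V.ind x) :
    n * (g U : ℝ) + k ≤ ∑ V ∈ s, c V * (g V : ℝ) := by
  have key : ∀ f : X.Meas → ℝ,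
      ∑ i : (Σ V : s, Fin (c V)), f i.1 = ∑ V ∈ s, c V * f V := fun f => by
    rw [Fintype.sum_sigma, ← Finset.sum_coe_sort s fun V => c V * f V]
    simp
  rw [← key fun V => (g V : ℝ)]
  refine hg.of_fintype (fun i : (Σ V : s, Fin (c V)) => i.1.1) U n k fun x => ?_
  rw [key fun V => V.ind x]
  exact h x

/-- The cover inequality with non-negative real multiplicities. -/
theorem CoverInequality.of_nonneg (hg : CoverInequality g) (s : Finset X.Meas) (c : X.Meas → ℝ)
    (hc : ∀ V, 0 ≤ c V) (U : X.Meas) {n k : ℝ} (hn : 0 ≤ n) (hk : 0 ≤ k)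
    (h : ∀ x, n * U.ind x + k ≤ ∑ V ∈ s, c V * V.ind x) :
    n * (g U : ℝ) + k ≤ ∑ V ∈ s, c V * (g V : ℝ) := by
  -- Scale by `N`, round the weights `c` up and `n`, `k` down. Since `g ≤ 1`, each rounding costs at
  -- most one, so the error does not grow with `N`.
  have hN : ∀ N : ℕ, (N : ℝ) * (n * (g U : ℝ) + k - ∑ V ∈ s, c V * (g V : ℝ)) ≤ s.card + 2 := by
    intro N
    have h₁ := hg.of_nat s (fun V => ⌈N * c V⌉₊) U ⌊N * n⌋₊ ⌊N * k⌋₊ fun x => by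
      calc (⌊N * n⌋₊ : ℝ) * U.ind x + ⌊N * k⌋₊ ≤ N * n * U.ind x + N * k :=
            add_le_add (mul_le_mul_of_nonneg_right (Nat.floor_le (by positivity))
              (U.ind_nonneg x)) (Nat.floor_le (by positivity))
        _ = N * (n * U.ind x + k) := by ring
        _ ≤ N * ∑ V ∈ s, c V * V.ind x := mul_le_mul_of_nonneg_left (h x) N.cast_nonneg
        _ = ∑ V ∈ s, N * c V * V.ind x := by
            rw [Finset.mul_sum]
            exact Finset.sum_congr rfl fun V _ => by ring
        _ ≤ ∑ V ∈ s, (⌈N * c V⌉₊ : ℝ) * V.ind x := Finset.sum_le_sum fun V _ =>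
            mul_le_mul_of_nonneg_right (Nat.le_ceil _) (V.ind_nonneg x)
    have h₂ : ∑ V ∈ s, (⌈N * c V⌉₊ : ℝ) * (g V : ℝ) ≤ N * (∑ V ∈ s, c V * (g V : ℝ)) + s.card := by
      have h₃ : ∀ V ∈ s, (⌈N * c V⌉₊ : ℝ) * (g V : ℝ) ≤ N * (c V * (g V : ℝ)) + 1 := by
        intro V _
        have h₄ := (Nat.ceil_lt_add_one (mul_nonneg N.cast_nonneg (hc V))).le
        have h₅ := mul_le_mul_of_nonneg_right h₄ (g V).2.1
        have h₆ : (g V : ℝ) ≤ 1 := (g V).2.2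
        linarith
      calc _ ≤ ∑ V ∈ s, ((N : ℝ) * (c V * (g V : ℝ)) + 1) := Finset.sum_le_sum h₃
        _ = _ := by rw [Finset.sum_add_distrib, Finset.mul_sum]; simp
    have h₇ := mul_le_mul_of_nonneg_right (Nat.lt_floor_add_one (N * n)).le (g U).2.1
    have h₈ := (Nat.lt_floor_add_one (N * k)).le
    have h₉ : (g U : ℝ) ≤ 1 := (g U).2.2
    linarith
  by_contra! hlt
  obtain ⟨N, hN'⟩ := exists_nat_gt
    ((s.card + 2 : ℝ) / (n * (g U : ℝ) + k - ∑ V ∈ s, c V * (g V : ℝ)))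
  rw [div_lt_iff₀ (sub_pos.2 hlt)] at hN'
  exact absurd (hN N) hN'.not_ge

/-! ### Formal combinations and the extension argument -/

/-- The step function with the given coefficients. -/
noncomputable def stepFun (X : UncSpace.{u}) : (X.Meas →₀ ℝ) →ₗ[ℝ] (X.carrier → ℝ) :=
  Finsupp.linearCombination ℝ Meas.ind

/-- The linear extension of a set function to formal combinations of measurable sets. -/
noncomputable def linearExt (g : X.Meas → unitInterval) : (X.Meas →₀ ℝ) →ₗ[ℝ] ℝ :=
  Finsupp.linearCombination ℝ fun U => (g U : ℝ)

@[simp] theorem stepFun_single (U : X.Meas) (r : ℝ) (x : X.carrier) :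
    stepFun X (Finsupp.single U r) x = r * U.ind x := by
  simp [stepFun]

@[simp] theorem linearExt_single (U : X.Meas) (r : ℝ) :
    linearExt g (Finsupp.single U r) = r * (g U : ℝ) := by
  simp [linearExt]

theorem stepFun_apply (a : X.Meas →₀ ℝ) (x : X.carrier) :
    stepFun X a x = ∑ V ∈ a.support, a V * V.ind x := by
  simp [stepFun, Finsupp.linearCombination_apply, Finsupp.sum, Finset.sum_apply]

theorem linearExt_apply (a : X.Meas →₀ ℝ) :
    linearExt g a = ∑ V ∈ a.support, a V * (g V : ℝ) := by
  simp [linearExt, Finsupp.linearCombination_apply, Finsupp.sum]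

/-- The cover inequality for formal combinations, where the constant may be negative. -/
theorem CoverInequality.le_linearExt (hg : CoverInequality g) (h₁ : g X.whole = 1)
    (a : X.Meas →₀ ℝ) (ha : 0 ≤ a) (U : X.Meas) {n k : ℝ} (hn : 0 ≤ n)
    (h : ∀ x, n * U.ind x + k ≤ stepFun X a x) : n * (g U : ℝ) + k ≤ linearExt g a := by
  have main : ∀ (b : X.Meas →₀ ℝ) (l : ℝ), 0 ≤ b → 0 ≤ l →
      (∀ x, n * U.ind x + l ≤ stepFun X b x) → n * (g U : ℝ) + l ≤ linearExt g b := by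
    intro b l hb hl hbl
    rw [linearExt_apply]
    refine hg.of_nonneg b.support b (fun V => hb V) U hn hl fun x => ?_
    rw [← stepFun_apply]
    exact hbl x
  rcases le_total 0 k with hk | hk
  · exact main a k ha hk h
  -- A negative constant is moved to the right as a multiple of `X`; this costs nothing because
  -- `g(X) = 1`.
  · have h₂ := main (a + Finsupp.single X.whole (-k)) 0
      (add_nonneg ha (Finsupp.single_nonneg.2 (neg_nonneg.2 hk))) le_rfl fun x => by
        have := h x
        simp only [map_add, Pi.add_apply, stepFun_single, ind_whole]
        linarith
    simp only [map_add, linearExt_single, h₁, Set.Icc.coe_one] at h₂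
    linarith

/-- The cone of the formal combinations on which all finitely additive probability measures
below `g` are non-negative. -/
noncomputable def dominationCone (g : X.Meas → unitInterval) : PointedCone ℝ (X.Meas →₀ ℝ) where
  -- If `μ ≤ g`, integrating the inequality gives `g(a) ≤ μ(c) + μ(a) ≤ μ(c) + g(a)`, hence `0 ≤
  -- μ(c)`.
  carrier := {c | ∃ a : X.Meas →₀ ℝ, 0 ≤ a ∧ ∀ x, linearExt g a ≤ stepFun X c x + stepFun X a x}
  zero_mem' := ⟨0, le_rfl, fun x => by simp⟩
  add_mem' := by
    rintro c d ⟨a, ha, hac⟩ ⟨b, hb, hbd⟩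
    refine ⟨a + b, add_nonneg ha hb, fun x => ?_⟩
    have h₁ := hac x
    have h₂ := hbd x
    simp only [map_add, Pi.add_apply]
    linarith
  smul_mem' := by
    rintro ⟨r, hr⟩ c ⟨a, ha, hac⟩
    refine ⟨r • a, smul_nonneg hr ha, fun x => ?_⟩
    have h₁ := mul_le_mul_of_nonneg_left (hac x) hr
    change linearExt g (r • a) ≤ stepFun X (r • c) x + stepFun X (r • a) x
    simp only [map_smul, Pi.smul_apply, smul_eq_mul]
    linarith

theorem mem_dominationCone_of_nonneg {c : X.Meas →₀ ℝ} (h : ∀ x, 0 ≤ stepFun X c x) :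
    c ∈ dominationCone g :=
  ⟨0, le_rfl, fun x => by simpa using h x⟩

theorem abs_stepFun_le (c : X.Meas →₀ ℝ) (x : X.carrier) :
    |stepFun X c x| ≤ ∑ V ∈ c.support, |c V| := by
  rw [stepFun_apply]
  refine (Finset.abs_sum_le_sum_abs _ _).trans (Finset.sum_le_sum fun V _ => ?_)
  rw [abs_mul, abs_of_nonneg (V.ind_nonneg x)]
  exact mul_le_of_le_one_right (abs_nonneg _) (V.ind_le_one x)

/-- A linear functional with the total mass one that is non-negative on the domination cone and
takes the same value as `g` on a given set. -/
theorem CoverInequality.exists_functional (hg : CoverInequality g) (h₁ : g X.whole = 1)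
    (U : X.Meas) : ∃ L : (X.Meas →₀ ℝ) →ₗ[ℝ] ℝ, (∀ c ∈ dominationCone g, 0 ≤ L c) ∧
      L (Finsupp.single X.whole 1) = 1 ∧ L (Finsupp.single U 1) = (g U : ℝ) := by
  let W : Submodule ℝ (X.Meas →₀ ℝ) :=
    Submodule.span ℝ {Finsupp.single X.whole 1, Finsupp.single U 1}
  have hX : Finsupp.single X.whole 1 ∈ W := Submodule.subset_span (by simp)
  have hU : Finsupp.single U 1 ∈ W := Submodule.subset_span (by simp)
  obtain ⟨L, hL, hpos⟩ := riesz_extension (dominationCone g) ⟨W, (linearExt g).domRestrict W⟩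
    (by
      rintro ⟨c, hc⟩ ⟨a, ha, hac⟩
      change 0 ≤ linearExt g c
      obtain ⟨r, q, rfl⟩ := Submodule.mem_span_pair.1 hc
      simp only [map_add, map_smul, Pi.add_apply, Pi.smul_apply, stepFun_single, ind_whole,
        smul_eq_mul, one_mul, mul_one, linearExt_single, h₁, Set.Icc.coe_one] at hac ⊢
      -- The element is `r X + q U` and the goal `0 ≤ r + q g(U)`. The term `q U` joins the covering
      -- side if `q ≥ 0` and the covered side if `q ≤ 0`.
      rcases le_total 0 q with hq | hq
      · have h₂ := hg.le_linearExt h₁ (a + Finsupp.single U q)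
          (add_nonneg ha (Finsupp.single_nonneg.2 hq)) U le_rfl (k := linearExt g a - r)
          fun x => by
            have := hac x
            simp only [map_add, Pi.add_apply, stepFun_single]
            linarith
        simp only [map_add, linearExt_single] at h₂
        linarith
      · have h₂ := hg.le_linearExt h₁ a ha U (neg_nonneg.2 hq) (k := linearExt g a - r)
          fun x => by
            have := hac x
            linarith
        linarith)
    (by
      intro y
      -- A large enough multiple of `X` makes any step function non-negative.
      refine ⟨⟨_, W.smul_mem (∑ V ∈ y.support, |y V|) hX⟩, mem_dominationCone_of_nonneg fun x => ?_⟩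
      have := (abs_le.1 (abs_stepFun_le y x)).1
      simp only [map_add, map_smul, Pi.add_apply, Pi.smul_apply, stepFun_single, ind_whole,
        smul_eq_mul, mul_one]
      linarith)
  refine ⟨L, hpos, ?_, ?_⟩
  · refine (hL ⟨_, hX⟩).trans ?_
    change linearExt g _ = 1
    simp [h₁]
  · refine (hL ⟨_, hU⟩).trans ?_
    change linearExt g _ = _
    simp

/-- A finitely additive probability measure below `g` that agrees with `g` on a given set. -/
theorem CoverInequality.exists_finAddProb (hg : CoverInequality g) (h₁ : g X.whole = 1)
    (U : X.Meas) : ∃ μ : FinAddProb X, (∀ V, (μ.toFun V : ℝ) ≤ g V) ∧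
      (μ.toFun U : ℝ) = g U := by
  obtain ⟨L, hpos, hX, hU⟩ := hg.exists_functional h₁ U
  have hle : ∀ V, L (Finsupp.single V 1) ≤ g V := by
    intro V
    -- With `a = V`, the combination `g(V) X - V` lies in the cone.
    have h₂ := hpos ((g V : ℝ) • Finsupp.single X.whole 1 - Finsupp.single V 1)
      ⟨Finsupp.single V 1, Finsupp.single_nonneg.2 zero_le_one, fun x => by
        simp [map_sub]⟩
    rw [map_sub, map_smul, hX, smul_eq_mul, mul_one] at h₂
    linarith
  have hnonneg : ∀ V, 0 ≤ L (Finsupp.single V 1) := fun V =>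
    hpos _ (mem_dominationCone_of_nonneg fun x => by
      rw [stepFun_single, one_mul]
      exact V.ind_nonneg x)
  -- Both `c` and `-c` lie in the cone, so `L` depends only on the step function; additivity follows
  -- from this.
  have hzero : ∀ c, (∀ x, stepFun X c x = 0) → L c = 0 := by
    intro c hc
    have h₂ := hpos c (mem_dominationCone_of_nonneg fun x => (hc x).ge)
    have h₃ := hpos (-c) (mem_dominationCone_of_nonneg fun x => by simp [hc x])
    rw [map_neg] at h₃
    linarith
  refine ⟨⟨fun V => ⟨L (Finsupp.single V 1), hnonneg V, (hle V).trans (g V).2.2⟩,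
    Subtype.ext (hzero _ fun x => by simp), Subtype.ext hX, fun V W hVW => ?_⟩, hle, hU⟩
  have h₂ := hzero (Finsupp.single (union V W) 1 - Finsupp.single V 1 - Finsupp.single W 1)
    fun x => by
      simp only [map_sub, Pi.sub_apply, stepFun_single, ind_union hVW]
      ring
  rw [map_sub, map_sub] at h₂
  change L _ = L _ + L _
  linarith

/-- A normalized set function that satisfies the cover inequality is an upper probability
measure. -/
theorem CoverInequality.isUpperProbability (hg : CoverInequality g) (h₁ : g X.whole = 1) :
    IsUpperProbability X g := by
  refine ⟨{μ | ∀ V, (μ.toFun V : ℝ) ≤ g V}, ?_, fun U => ?_⟩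
  · obtain ⟨μ, hμ, -⟩ := hg.exists_finAddProb h₁ X.whole
    exact ⟨μ, hμ⟩
  · obtain ⟨μ, hμ, hU⟩ := hg.exists_finAddProb h₁ U
    have hmax : IsGreatest ((fun μ : FinAddProb X => (μ.toFun U : ℝ)) ''
        {μ | ∀ V, (μ.toFun V : ℝ) ≤ g V}) (g U) := by
      refine ⟨⟨μ, hμ, hU⟩, ?_⟩
      rintro _ ⟨ν, hν, rfl⟩
      exact hν U
    exact hmax.csSup_eq.symm

end UpperProbLogic
namespace UpperProbLogic

/-! ### Membership in maximal sets -/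

namespace DeductionSystem

variable {T S : PolyFunctor.{u}} {D : DeductionSystem T}

theorem mem_of_provable {h : S ∈ T.Ing} (x : D.CanonicalPoint h) {φ : Form T S}
    (hφ : D.Entails h ∅ φ) : φ ∈ x.1 :=
  mem_of_entails x (D.cut h _ ∅ φ (fun _ hψ => hψ.elim) hφ)

theorem mem_of_subset {h : S ∈ T.Ing} (x : D.CanonicalPoint h) {Γ : Set (Form T S)}
    {φ : Form T S} (hΓ : Γ ⊆ x.1) (hφ : D.Entails h Γ φ) : φ ∈ x.1 :=
  mem_of_entails x (D.cut h _ Γ φ (fun _ hψ => D.assumption h _ _ (Or.inl (hΓ hψ))) hφ)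

theorem mem_of_isAxiom {h : S ∈ T.Ing} (x : D.CanonicalPoint h) {φ : Form T S}
    (hφ : IsAxiom T S φ) : φ ∈ x.1 :=
  mem_of_entails x (D.assumption h _ _ (Or.inr hφ))

/-- If `φ` is not provable, then `¬φ` is consistent, for otherwise deduction would give `¬¬φ`; a
maximal set containing `¬φ` then omits `φ`. -/
theorem IsLindenbaum.provable_of_forall_mem (hD : D.IsLindenbaum) {h : S ∈ T.Ing}
    {φ : Form T S} (hφ : ∀ x : D.CanonicalPoint h, φ ∈ x.1) : D.Entails h ∅ φ := by
  by_contra hn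
  have hc : D.IsConsistent h {Form.neg φ} := by
    intro hb
    have h₁ : D.Entails h ∅ (Form.neg (Form.neg φ)) :=
      D.deduction h ∅ _ _ (by rwa [Set.empty_union])
    refine hn (entails_mp h₁ (D.assumption h _ _ (Or.inr (IsAxiom.taut _ ?_))))
    intro v hv hi
    rw [hi]
    intro h₂
    by_contra h₃
    exact hv ((hi _ _).1 h₂ ((hi _ _).2 fun h₄ => absurd h₄ h₃))
  obtain ⟨Δ, hΔ, hmax⟩ := hD S h _ hc
  exact (neg_mem_iff (⟨Δ, hmax⟩ : D.CanonicalPoint h) φ).1 (hΔ rfl) (hφ ⟨Δ, hmax⟩)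

variable {h : S ∈ T.Ing} (x : D.CanonicalPoint h)

theorem or_mem_iff (φ ψ : Form T S) : Form.or φ ψ ∈ x.1 ↔ φ ∈ x.1 ∨ ψ ∈ x.1 := by
  rw [Form.or, imp_mem_iff, neg_mem_iff]
  tauto

theorem and_mem_iff (φ ψ : Form T S) : Form.and φ ψ ∈ x.1 ↔ φ ∈ x.1 ∧ ψ ∈ x.1 := by
  rw [Form.and, neg_mem_iff, or_mem_iff, neg_mem_iff, neg_mem_iff]
  tauto

theorem bigAnd_mem_iff (l : List (Form T S)) : Form.bigAnd l ∈ x.1 ↔ ∀ φ ∈ l, φ ∈ x.1 := by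
  induction l with
  | nil =>
    have : Form.top ∈ x.1 := (neg_mem_iff x _).2 (bot_not_mem x)
    simpa [Form.bigAnd] using this
  | cons φ l ih =>
    rw [List.forall_mem_cons, ← ih]
    exact and_mem_iff x φ (Form.bigAnd l)

theorem bigOr_mem_iff (l : List (Form T S)) : Form.bigOr l ∈ x.1 ↔ ∃ φ ∈ l, φ ∈ x.1 := by
  induction l with
  | nil => simpa [Form.bigOr] using bot_not_mem x
  | cons φ l ih =>
    rw [List.exists_mem_cons_iff, ← ih]
    exact or_mem_iff x φ (Form.bigOr l)

theorem atLeast_mem {m r : ℕ} {φ : Fin m → Form T S} {J : Finset (Fin m)} (hJ : J.card = r)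
    (h : ∀ i ∈ J, φ i ∈ x.1) : Form.atLeast r φ ∈ x.1 := by
  rw [Form.atLeast, bigOr_mem_iff]
  -- The disjuncts are indexed by sublists of `List.finRange m`, so `J` has to be listed in
  -- increasing order.
  let l := (List.finRange m).filter (· ∈ J)
  have hl : ∀ i, i ∈ l ↔ i ∈ J := fun i => by simp [l]
  have hlen : l.length = r := by
    rw [← List.toFinset_card_of_nodup ((List.nodup_finRange m).filter _), ← hJ]
    congr 1
    ext i
    rw [List.mem_toFinset]
    exact hl i
  refine ⟨Form.bigAnd (l.map φ), List.mem_map.2 ⟨l, List.mem_sublistsLen.2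
    ⟨List.filter_sublist, hlen⟩, rfl⟩, (bigAnd_mem_iff x _).2 fun ψ hψ => ?_⟩
  obtain ⟨i, hi, rfl⟩ := List.mem_map.1 hψ
  exact h i ((hl i).1 hi)

theorem IsLindenbaum.provable_atLeast (hD : D.IsLindenbaum) {h : S ∈ T.Ing} {m k : ℕ}
    {ψ : Fin m → MForm T S}
    (hψ : Covers (fun i => D.truthSet h (ψ i).1) k Set.univ) :
    D.Entails h ∅ (Form.atLeast k fun i => (ψ i).1) :=
  hD.provable_of_forall_mem fun x =>
    let ⟨_, hJ, hx⟩ := hψ x trivial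
    atLeast_mem x hJ hx

theorem IsLindenbaum.provable_imp_atLeast (hD : D.IsLindenbaum) {h : S ∈ T.Ing} {m k : ℕ}
    {φ : MForm T S} {ψ : Fin m → MForm T S}
    (hψ : Covers (fun i => D.truthSet h (ψ i).1) k (D.truthSet h φ.1)) :
    D.Entails h ∅ (Form.imp φ.1 (Form.atLeast k fun i => (ψ i).1)) :=
  hD.provable_of_forall_mem fun x => (imp_mem_iff x _ _).2 fun hφ =>
    let ⟨_, hJ, hx⟩ := hψ x hφ
    atLeast_mem x hJ hx

/-! ### The canonical measure -/

section Canonical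

variable {hS : PolyFunctor.upper S ∈ T.Ing} (x : D.CanonicalPoint hS)

theorem upperLT_mem_iff (φ : MForm T S) (p : unitInterval) :
    φ.upperLT p ∈ x.1 ↔ φ.upperGE p ∉ x.1 := neg_mem_iff x _

theorem upperLE_of_not_upperGE {φ : MForm T S} {p : unitInterval} (h : φ.upperGE p ∉ x.1) :
    φ.upperLE p ∈ x.1 :=
  (imp_mem_iff x _ _).1 (mem_of_isAxiom x (.upper_lt_le p φ)) ((upperLT_mem_iff x φ p).2 h)

theorem not_upperGE_of_upperLE {φ : MForm T S} {p q : unitInterval} (hpq : p < q)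
    (h : φ.upperLE p ∈ x.1) : φ.upperGE q ∉ x.1 :=
  (upperLT_mem_iff x φ q).1 ((imp_mem_iff x _ _).1 (mem_of_isAxiom x (.upper_le_lt p q hpq φ)) h)

/-- If `U^{≥p}φ` failed, then `U^{<p}φ`, so `U^{≤p}φ`, so `U^{<q}φ` would hold, against `U^{≥q}φ`.
-/
theorem upperGE_antitone {φ : MForm T S} {p q : unitInterval} (hpq : p ≤ q)
    (h : φ.upperGE q ∈ x.1) : φ.upperGE p ∈ x.1 := by
  rcases hpq.eq_or_lt with rfl | hlt
  · exact h
  · by_contra hn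
    exact not_upperGE_of_upperLE x hlt (upperLE_of_not_upperGE x hn) h

theorem upperGE_zero_mem (φ : MForm T S) : φ.upperGE 0 ∈ x.1 := by
  -- At `p = 0` the Archimedean rule has no premises.
  refine mem_of_subset x ?_ (D.archimedeanUpper hS 0 φ)
  rintro _ ⟨q, hq, rfl⟩
  exact absurd hq (not_lt.2 q.2.1)

/-- The supremum of the numbers `q` for which the formula `U^{≥q}φ` belongs to `x`. -/
noncomputable def canonicalValue (φ : MForm T S) : unitInterval :=
  sSup {q | φ.upperGE q ∈ x.1}

/-- The Archimedean rule for `U` makes the supremum a maximum. -/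
theorem upperGE_mem_iff (φ : MForm T S) (p : unitInterval) :
    φ.upperGE p ∈ x.1 ↔ p ≤ canonicalValue x φ := by
  refine ⟨fun h => le_sSup h, fun h => upperGE_antitone x h ?_⟩
  refine mem_of_subset x ?_ (D.archimedeanUpper hS _ φ)
  rintro _ ⟨q, hq, rfl⟩
  obtain ⟨r, hr, hqr⟩ := lt_sSup_iff.1 (show q < sSup {q | φ.upperGE q ∈ x.1} from hq)
  exact upperGE_antitone x hqr.le hr

theorem upperLE_mem_iff (φ : MForm T S) (p : unitInterval) :
    φ.upperLE p ∈ x.1 ↔ canonicalValue x φ ≤ p := by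
  constructor
  · intro h
    by_contra! hlt
    exact not_upperGE_of_upperLE x hlt h ((upperGE_mem_iff x φ _).2 le_rfl)
  · intro h
    -- By definition `U^{≤p}φ` is `L^{≥1-p}¬φ`, so the rule for `L` reduces it to the formulas
    -- `U^{≤p'}φ` with `p' > p`; these hold because `U^{≥p'}φ` fails.
    refine mem_of_subset x ?_ (D.archimedeanLower hS (unitInterval.symm p) φ.neg)
    rintro _ ⟨q, hq, rfl⟩
    have hq' : p < unitInterval.symm q := unitInterval.lt_symm_comm.1 hq
    have h₁ : φ.upperLE (unitInterval.symm q) ∈ x.1 := upperLE_of_not_upperGE x fun hc =>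
      (h.trans_lt hq').not_ge ((upperGE_mem_iff x φ _).1 hc)
    rwa [MForm.upperLE, unitInterval.symm_symm] at h₁

/-- The inclusion makes `φ → ψ` provable; necessitation then puts `L^{≥1}(φ → ψ)` into `x`, and the
monotonicity axiom applies. -/
theorem canonicalValue_mono (hD : D.IsLindenbaum) {φ ψ : MForm T S}
    (h : D.truthSet (PolyFunctor.of_upper_mem_Ing hS) φ.1 ⊆
      D.truthSet (PolyFunctor.of_upper_mem_Ing hS) ψ.1) :
    canonicalValue x φ ≤ canonicalValue x ψ := by
  have h₁ : D.Entails (PolyFunctor.of_upper_mem_Ing hS) ∅ (MForm.imp φ ψ).1 :=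
    hD.provable_of_forall_mem fun y => (imp_mem_iff y _ _).2 fun hy => h hy
  have h₂ := (imp_mem_iff x _ _).1 (mem_of_isAxiom x (.upper_mono (canonicalValue x φ) φ ψ))
    (mem_of_provable x (D.necessitation hS _ h₁))
  exact (upperGE_mem_iff x ψ _).1 ((imp_mem_iff x _ _).1 h₂ ((upperGE_mem_iff x φ _).2 le_rfl))

/-! ### Existence and uniqueness of the canonical measure -/

theorem isLUB_canonicalValue (φ : MForm T S) :
    IsLUB ((fun q : unitInterval => (q : ℝ)) '' {q | φ.upperGE q ∈ x.1})
      (canonicalValue x φ : ℝ) := by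
  refine IsGreatest.isLUB ⟨⟨_, (upperGE_mem_iff x φ _).2 le_rfl, rfl⟩, ?_⟩
  rintro _ ⟨q, hq, rfl⟩
  exact (upperGE_mem_iff x φ q).1 hq

theorem existsUnique_isCanonicalMeasure (hD : D.IsLindenbaum) :
    ∃! g : (D.canonicalSpace (PolyFunctor.of_upper_mem_Ing hS)).Meas → unitInterval,
      D.IsCanonicalMeasure hS x g := by
  -- The choice of representatives is harmless: formulas with equal truth sets have equal values, by
  -- monotonicity in both directions.
  choose φ hφ using fun U : (D.canonicalSpace (PolyFunctor.of_upper_mem_Ing hS)).Meas => U.2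
  refine ⟨fun U => canonicalValue x (φ U), fun ψ => ?_, fun g hg => funext fun U => ?_⟩
  · have h₁ := hφ (D.measTruthSet (PolyFunctor.of_upper_mem_Ing hS) ψ)
    have h₂ : canonicalValue x (φ (D.measTruthSet (PolyFunctor.of_upper_mem_Ing hS) ψ)) =
        canonicalValue x ψ :=
      le_antisymm (canonicalValue_mono x hD h₁.le) (canonicalValue_mono x hD h₁.ge)
    simpa only [h₂] using isLUB_canonicalValue x ψ
  · have h₁ : D.measTruthSet (PolyFunctor.of_upper_mem_Ing hS) (φ U) = U := Subtype.ext (hφ U)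
    have h₂ := (hg (φ U)).unique (isLUB_canonicalValue x (φ U))
    rw [h₁] at h₂
    exact Subtype.ext h₂

/-! ### Normalization and the cover inequality -/

variable {x} {g : (D.canonicalSpace (PolyFunctor.of_upper_mem_Ing hS)).Meas → unitInterval}

theorem IsCanonicalMeasure.apply_eq (hg : D.IsCanonicalMeasure hS x g) (φ : MForm T S) :
    g (D.measTruthSet _ φ) = canonicalValue x φ :=
  Subtype.ext ((hg φ).unique (isLUB_canonicalValue x φ))

theorem IsCanonicalMeasure.map_empty (hg : D.IsCanonicalMeasure hS x g) :
    g (UncSpace.empty _) = 0 := by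
  have h₁ : UncSpace.empty _ = D.measTruthSet (PolyFunctor.of_upper_mem_Ing hS) MForm.bot :=
    Subtype.ext (Set.eq_empty_iff_forall_notMem.2 fun y hy => bot_not_mem y hy).symm
  rw [h₁, hg.apply_eq]
  refine le_antisymm ((upperLE_mem_iff x _ _).1 ?_) (canonicalValue x _).2.1
  have h₂ : D.Entails (PolyFunctor.of_upper_mem_Ing hS) ∅ (MForm.bot : MForm T S).neg.1 :=
    D.assumption _ _ _ (Or.inr (IsAxiom.taut _ fun v hv hi => (hi _ _).2 id))
  -- `U^{≤0}⊥` unfolds to `L^{≥1}¬⊥`, an instance of necessitation.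
  rw [MForm.upperLE, unitInterval.symm_zero]
  exact mem_of_provable x (D.necessitation hS _ h₂)

theorem bigAnd_upperLE_mem (x : D.CanonicalPoint hS) {m : ℕ} (ψ : Fin m → MForm T S) :
    Form.bigAnd (List.ofFn fun i => (ψ i).upperLE (canonicalValue x (ψ i))) ∈ x.1 := by
  refine (bigAnd_mem_iff x _).2 fun χ hχ => ?_
  obtain ⟨i, rfl⟩ := List.mem_ofFn.1 hχ
  exact (upperLE_mem_iff x _ _).2 le_rfl

theorem IsCanonicalMeasure.coverInequality (hD : D.IsLindenbaum)
    (hg : D.IsCanonicalMeasure hS x g) : CoverInequality g := by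
  rintro m n k V U ⟨hk, hnk⟩
  obtain ⟨U, φ, rfl⟩ := U
  choose ψ hψ using fun i => (V i).2
  obtain rfl : V = fun i => D.measTruthSet _ (ψ i) := funext fun i => Subtype.ext (hψ i).symm
  change (k : ℝ) + n * (g (D.measTruthSet _ φ) : ℝ) ≤ _
  simp only [hg.apply_eq]
  have hchi := hD.provable_atLeast hk
  -- The second cover rule settles `n = 0`, which the first excludes, and shows that truncation at
  -- zero in the first rule has no effect.
  have hle : (k : ℝ) ≤ ∑ i, (canonicalValue x (ψ i) : ℝ) := by
    by_contra! hlt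
    exact (neg_mem_iff x _).1 (mem_of_provable x (D.cover₂ hS m k ψ _ hchi hlt))
      (bigAnd_upperLE_mem x ψ)
  rcases n.eq_zero_or_pos with rfl | hn
  · simpa using hle
  have h₁ := (imp_mem_iff x _ _).1 (mem_of_provable x (D.cover₁ hS m n k hn φ ψ _
    (hD.provable_imp_atLeast hnk) hchi)) (bigAnd_upperLE_mem x ψ)
  have h₂ : (canonicalValue x φ : ℝ) ≤ ((Set.projIcc 0 1 zero_le_one
    (((∑ i, (canonicalValue x (ψ i) : ℝ)) - k) / n) : unitInterval) : ℝ) :=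
    (upperLE_mem_iff x φ _).1 h₁
  have hn' : (0 : ℝ) < n := Nat.cast_pos.2 hn
  rw [Set.coe_projIcc] at h₂
  have h₃ := h₂.trans (max_le (div_nonneg (sub_nonneg.2 hle) hn'.le) (min_le_right _ _))
  rw [le_div_iff₀ hn'] at h₃
  linarith

theorem IsCanonicalMeasure.map_whole (hD : D.IsLindenbaum) (hg : D.IsCanonicalMeasure hS x g) :
    g (UncSpace.whole _) = 1 := by
  have hc : Covers (fun _ : Fin 1 =>
      (UncSpace.whole (D.canonicalSpace (PolyFunctor.of_upper_mem_Ing hS))).1) 1 Set.univ :=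
    fun y _ => ⟨Finset.univ, rfl, fun _ _ => trivial⟩
  -- The single set `X` is a `(0,1)`-cover of `(∅,X)`, whence `1 ≤ g(X)`.
  have h₁ := hg.coverInequality hD 1 0 1 (fun _ => UncSpace.whole _) (UncSpace.empty _)
    ⟨hc, fun y hy => hy.elim⟩
  refine le_antisymm (g _).2.2 (Subtype.coe_le_coe.1 ?_)
  simpa using h₁

end Canonical

end DeductionSystem

end UpperProbLogic

open UpperProbLogic
theorem theorem4p3 (T : PolyFunctor.{u}) (D : DeductionSystem T) (hD : D.IsLindenbaum)
    (S : PolyFunctor.{u}) (hS : PolyFunctor.upper S ∈ T.Ing) (x : D.CanonicalPoint hS) :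
    (∃! g : (D.canonicalSpace (PolyFunctor.of_upper_mem_Ing hS)).Meas → unitInterval,
      D.IsCanonicalMeasure hS x g) ∧
    ∀ g : (D.canonicalSpace (PolyFunctor.of_upper_mem_Ing hS)).Meas → unitInterval,
      D.IsCanonicalMeasure hS x g →
        IsUpperProbability (D.canonicalSpace (PolyFunctor.of_upper_mem_Ing hS)) g ∧
        g (UncSpace.empty _) = 0 ∧
        g (UncSpace.whole _) = 1 ∧
        ∀ (m n k : ℕ) (V : Fin m → (D.canonicalSpace (PolyFunctor.of_upper_mem_Ing hS)).Meas)
          (U : (D.canonicalSpace (PolyFunctor.of_upper_mem_Ing hS)).Meas),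
          IsNKCover n k V U → (k : ℝ) + n * (g U : ℝ) ≤ ∑ i, (g (V i) : ℝ) := by
  refine ⟨DeductionSystem.existsUnique_isCanonicalMeasure x hD, fun g hg => ?_⟩
  have h₁ := hg.map_whole hD
  exact ⟨(hg.coverInequality hD).isUpperProbability h₁, hg.map_empty, h₁, hg.coverInequality hD⟩
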